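/- Let $(M,g)$ be a spacetime, i.e. a smooth finite-dimensional manifold without boundary with a smooth metric of signature $(-,+,\dots,+)$, and let $\Sigma\subset M$ be a Cauchy slice or, more generally, any smooth embedded spacelike hypersurface. The *light cone* of a point $V\in M$ consists of $V$ and of all points joined to $V$ by a (future- or past-directed) null geodesic, and the *lightsphere* with vertex $V$ is the intersection of $\Sigma$ with the light cone of $V$. A set $A\subset\Sigma$ has *smooth boundary* if every $p$ in its boundary $\partial A$ (relative to $\Sigma$) has a neighbourhood in $\Sigma$ on which there is a smooth real function $h$ with $dh_p\neq 0$ such that there $\{h<0\}\subset A\subset\{h\le 0\}$. The lightsphere with vertex $V$ is *externally tangential* to $\partial A$ at $p\in\partial A$ if there is a null geodesic $\gamma$ from $V$ to $p$ such that (i) the sheet of the lightsphere swept out by the null geodesics from $V$ near $\gamma$ has the same tangent space at $p$ as $\partial A$, and (ii) the orthogonal projection to $T_p\Sigma$ of the velocity with which $\gamma$ arrives at $p$ points into $A$ (the light ray arrives from the outside of $A$). The region $A$ is *Rindler-convex* if it has smooth boundary and every lightsphere that is externally tangential to $\partial A$ at some point is disjoint from the interior of $A$ (relative to $\Sigma$).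 **Theorem.** If $A,B\subset\Sigma$ are Rindler-convex and $A\cap B$ has smooth boundary, then $A\cap B$ is Rindler-convex. -/

import Mathlib

open Set Filter Topology Bundle
open scoped Manifold ContDiff

noncomputable section

/-- A smooth Lorentzian metric, of signature `(-, +, …, +)`, on a smooth manifold `M` modelled on
the vector space `E`. -/
structure LorentzMetric (E : Type*) [NormedAddCommGroup E] [NormedSpace ℝ E]
    (M : Type*) [TopologicalSpace M] [ChartedSpace E M] [IsManifold 𝓘(ℝ, E) ∞ M] where
  /-- The bilinear form on each tangent space. -/
  val (x : M) : TangentSpace 𝓘(ℝ, E) x →L[ℝ] TangentSpace 𝓘(ℝ, E) x →L[ℝ] ℝ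
  symm (x : M) (v w : TangentSpace 𝓘(ℝ, E) x) : val x v w = val x w v
  /-- At every point there is a timelike vector, and the form is positive definite on its
  orthogonal complement. -/
  lorentzian (x : M) : ∃ v : TangentSpace 𝓘(ℝ, E) x, val x v v < 0 ∧
    ∀ w : TangentSpace 𝓘(ℝ, E) x, val x v w = 0 → w ≠ 0 → 0 < val x w w
  contMDiff : ContMDiff 𝓘(ℝ, E) (𝓘(ℝ, E).prod 𝓘(ℝ, E →L[ℝ] E →L[ℝ] ℝ)) ∞
    (fun x ↦ TotalSpace.mk' (E →L[ℝ] E →L[ℝ] ℝ)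
      (E := fun y : M ↦ TangentSpace 𝓘(ℝ, E) y →L[ℝ] TangentSpace 𝓘(ℝ, E) y →L[ℝ] ℝ) x (val x))

section Curves

variable {E : Type*} [NormedAddCommGroup E] [NormedSpace ℝ E]
  {M : Type*} [TopologicalSpace M] [ChartedSpace E M]

/-- The velocity of the curve `γ` at time `t`. -/
def curveVelocity (E : Type*) [NormedAddCommGroup E] [NormedSpace ℝ E]
    {M : Type*} [TopologicalSpace M] [ChartedSpace E M] (γ : ℝ → M) (t : ℝ) :
    TangentSpace 𝓘(ℝ, E) (γ t) :=
  mfderiv 𝓘(ℝ, ℝ) 𝓘(ℝ, E) γ t (1 : ℝ)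

variable [IsManifold 𝓘(ℝ, E) ∞ M]

/-- The metric in the chart at `x₀`: its components, as a function on the coordinate space. -/
def LorentzMetric.inChart (g : LorentzMetric E M) (x₀ : M) (y : E) : E →L[ℝ] E →L[ℝ] ℝ :=
  let B : E →L[ℝ] E →L[ℝ] ℝ := g.val ((extChartAt 𝓘(ℝ, E) x₀).symm y)
  let D : E →L[ℝ] E := mfderiv 𝓘(ℝ, E) 𝓘(ℝ, E) (extChartAt 𝓘(ℝ, E) x₀).symm y
  B.bilinearComp D D

/-- `γ` is an (affinely parametrized) geodesic of the Levi-Civita connection on the open set `J`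
of times. With `c` the coordinate expression of `γ` in the chart at `γ t` and `G` that of the
metric, the equation is `G_{ij} c''^j + ∂_k G_{ij} c'^k c'^j - (1/2) ∂_i G_{jk} c'^j c'^k = 0`,
which is `c''^i + Γ^i_{jk} c'^j c'^k = 0` with the index `i` lowered. -/
def LorentzMetric.IsGeodesicOn (g : LorentzMetric E M) (γ : ℝ → M) (J : Set ℝ) : Prop :=
  ContMDiffOn 𝓘(ℝ, ℝ) 𝓘(ℝ, E) ∞ γ J ∧
  ∀ t ∈ J, ∀ w : E,
    let c : ℝ → E := fun s ↦ extChartAt 𝓘(ℝ, E) (γ t) (γ s)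
    let G : E → E →L[ℝ] E →L[ℝ] ℝ := g.inChart (γ t)
    G (c t) (deriv (deriv c) t) w + fderiv ℝ G (c t) (deriv c t) (deriv c t) w
      - (1 / 2 : ℝ) * fderiv ℝ G (c t) w (deriv c t) (deriv c t) = 0

/-- `γ`, restricted to `[0, 1]`, is a null geodesic (future- or past-directed) from `V` to `Q`. -/
def LorentzMetric.IsNullGeodesicFromTo (g : LorentzMetric E M) (γ : ℝ → M) (V Q : M) : Prop :=
  γ 0 = V ∧ γ 1 = Q ∧ ∃ J : Set ℝ, IsOpen J ∧ Icc 0 1 ⊆ J ∧ g.IsGeodesicOn γ J ∧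
    ∀ t ∈ J, curveVelocity E γ t ≠ 0 ∧
      g.val (γ t) (curveVelocity E γ t) (curveVelocity E γ t) = 0

/-- The light cone of the vertex `V`: the union of all null geodesics through `V`, to the future
and to the past, together with `V` itself. -/
def LorentzMetric.lightcone (g : LorentzMetric E M) (V : M) : Set M :=
  {V} ∪ {Q | ∃ γ : ℝ → M, g.IsNullGeodesicFromTo γ V Q}

end Curves

section Slices

variable {E : Type*} [NormedAddCommGroup E] [NormedSpace ℝ E]
  {M : Type*} [TopologicalSpace M] [ChartedSpace E M] [IsManifold 𝓘(ℝ, E) ∞ M]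
  {F : Type*} [NormedAddCommGroup F] [NormedSpace ℝ F]
  {S : Type*} [TopologicalSpace S] [ChartedSpace F S]

/-- `ι` embeds the manifold `S` as a smooth spacelike hypersurface of the spacetime `(M, g)`.
Every Cauchy slice is of this kind, including the usual time slices of spacetimes with a conformal
boundary. -/
structure IsSpacelikeSlice (g : LorentzMetric E M) (ι : S → M) : Prop where
  contMDiff : ContMDiff 𝓘(ℝ, F) 𝓘(ℝ, E) ∞ ι
  isEmbedding : IsEmbedding ι
  codim_one : Module.finrank ℝ F + 1 = Module.finrank ℝ E
  /-- The induced metric is Riemannian (in particular, `ι` is an immersion). -/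
  spacelike (p : S) (w : TangentSpace 𝓘(ℝ, F) p) : w ≠ 0 →
    0 < g.val (ι p) (mfderiv 𝓘(ℝ, F) 𝓘(ℝ, E) ι p w) (mfderiv 𝓘(ℝ, F) 𝓘(ℝ, E) ι p w)

/-- The lightsphere with vertex `V`: the intersection of the slice with the light cone of `V`. -/
def lightsphere (g : LorentzMetric E M) (ι : S → M) (V : M) : Set S :=
  ι ⁻¹' g.lightcone V

/-- The differential at `p` of a real function `h` on the slice. -/
def differentialAt (h : S → ℝ) (p : S) : TangentSpace 𝓘(ℝ, F) p →L[ℝ] ℝ :=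
  mfderiv 𝓘(ℝ, F) 𝓘(ℝ, ℝ) h p

/-- Near its boundary point `p`, the region `A` is the sublevel set of the smooth function `h`,
which has nonzero differential at `p`. Points of the boundary `{h = 0}` itself may or may not
belong to `A`, so that open and closed regions are both covered. -/
def IsBoundaryDefiningAt (A : Set S) (p : S) (h : S → ℝ) : Prop :=
  p ∈ frontier A ∧ differentialAt (F := F) h p ≠ 0 ∧
  ∃ U : Set S, IsOpen U ∧ p ∈ U ∧ ContMDiffOn 𝓘(ℝ, F) 𝓘(ℝ, ℝ) ∞ h U ∧
    ∀ q ∈ U, (h q < 0 → q ∈ A) ∧ (q ∈ A → h q ≤ 0)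

/-- The region `A` of the manifold `S` has a smooth boundary. -/
def HasSmoothBoundary (F : Type*) [NormedAddCommGroup F] [NormedSpace ℝ F]
    {S : Type*} [TopologicalSpace S] [ChartedSpace F S] (A : Set S) : Prop :=
  ∀ p ∈ frontier A, ∃ h : S → ℝ, IsBoundaryDefiningAt (F := F) A p h

/-- The tangent vectors at `p` to the sheet of the lightsphere with vertex `V` on which the null
geodesic `γ` from `V` arrives at `p`: the velocities at `p` of the curves `s ↦ c s` in the slice
that are traced out by the end points of smooth families of null geodesics `Γ s` from `V` with
`Γ 0 = γ`. -/
def IsTangentToLightsphere (g : LorentzMetric E M) (ι : S → M) (V : M) (γ : ℝ → M) (p : S)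
    (w : TangentSpace 𝓘(ℝ, F) p) : Prop :=
  ∃ (Γ : ℝ → ℝ → M) (c : ℝ → S),
    (∀ t ∈ Icc (0 : ℝ) 1, Γ 0 t = γ t) ∧
    (∃ W : Set (ℝ × ℝ), IsOpen W ∧ (∀ t ∈ Icc (0 : ℝ) 1, ((0 : ℝ), t) ∈ W) ∧
      ContMDiffOn 𝓘(ℝ, ℝ × ℝ) 𝓘(ℝ, E) ∞ (fun z : ℝ × ℝ ↦ Γ z.1 z.2) W) ∧
    c 0 = p ∧
    (∃ ε : ℝ, 0 < ε ∧ ContMDiffOn 𝓘(ℝ, ℝ) 𝓘(ℝ, F) ∞ c (Ioo (-ε) ε) ∧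
      ∀ s ∈ Ioo (-ε) ε, g.IsNullGeodesicFromTo (Γ s) V (ι (c s))) ∧
    curveVelocity F c 0 = w

/-- The lightsphere with vertex `V` is externally tangential to the boundary of `A` at `p`: some
sheet of it passes through `p`, belonging to a null geodesic `γ` from `V` to `p`, such that
* the tangent space of this sheet at `p` is the tangent space `ker dh` of the boundary of `A`;
* the spatial direction `u` in which the light ray `γ` arrives at `p` (the orthogonal projection of
  its velocity to the slice) points into `A`, so that the ray comes from the outside of `A`. -/
def IsExternallyTangentAt (g : LorentzMetric E M) (ι : S → M) (A : Set S) (V : M) (p : S) : Prop :=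
  ∃ (h : S → ℝ) (γ : ℝ → M), IsBoundaryDefiningAt (F := F) A p h ∧
    g.IsNullGeodesicFromTo γ V (ι p) ∧
    (∀ w : TangentSpace 𝓘(ℝ, F) p,
      IsTangentToLightsphere g ι V γ p w ↔ differentialAt h p w = 0) ∧
    ∃ u : TangentSpace 𝓘(ℝ, F) p,
      (∀ w : TangentSpace 𝓘(ℝ, F) p,
        g.val (ι p) (mfderiv 𝓘(ℝ, F) 𝓘(ℝ, E) ι p u) (mfderiv 𝓘(ℝ, F) 𝓘(ℝ, E) ι p w)
          = g.val (ι p) (curveVelocity E γ 1) (mfderiv 𝓘(ℝ, F) 𝓘(ℝ, E) ι p w)) ∧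
      differentialAt h p u < 0

/-- A region `A` of the slice is Rindler-convex: it has a smooth boundary, and any lightsphere
externally tangential to its boundary never reaches the inside of `A`. -/
def IsRindlerConvex (F : Type*) [NormedAddCommGroup F] [NormedSpace ℝ F]
    {S : Type*} [TopologicalSpace S] [ChartedSpace F S]
    (g : LorentzMetric E M) (ι : S → M) (A : Set S) : Prop :=
  HasSmoothBoundary F A ∧
  ∀ (V : M) (p : S), IsExternallyTangentAt (F := F) g ι A V p →
    Disjoint (lightsphere g ι V) (interior A)

end Slices

end

/-! A boundary point `p` of `A ∩ B` lies on the boundary of `A` or of `B`, say of `A`. Let `h` and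
`k` define `A ∩ B` and `A` near `p`. Both vanish at `p`, and `A ∩ B ⊆ A` gives `k ≤ 0` wherever `h <
0`; to first order, `dh w < 0` forces `dk w ≤ 0` (`IsBoundaryDefiningAt.nonpos_of_subset`). As
neither differential is zero, they have the same kernel and the same inward side. External tangency
sees the region only through these two data, so it passes from `A ∩ B` to `A`; convexity of `A` then
keeps the lightsphere out of `interior A`, which contains `interior (A ∩ B)`. No property of
geodesics is needed. -/

/-- If `φ w < 0` implies `ψ w ≤ 0` and `ψ ≠ 0`, then `φ w < 0` even implies `ψ w < 0`. -/
lemma neg_of_neg_imp_nonpos {F : Type*} [NormedAddCommGroup F] [NormedSpace ℝ F]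
    {φ ψ : F →L[ℝ] ℝ} (hψ : ψ ≠ 0) (h : ∀ w, φ w < 0 → ψ w ≤ 0) {u : F} (hu : φ u < 0) :
    ψ u < 0 := by
  refine lt_of_le_of_ne (h u hu) fun h0 ↦ hψ (ContinuousLinearMap.ext fun z ↦ ?_)
  -- Since `ψ u = 0`, a large multiple of `u` added to a positive multiple of `z` makes `φ` negative
  -- without affecting the sign of `ψ z`.
  have key (z : F) : ψ z ≤ 0 := by
    have hpos : 0 < |φ z| + 1 := by positivity
    have h1 : φ ((|φ z| + 1) • u + (-φ u) • z) < 0 := by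
      simp only [map_add, map_smul, smul_eq_mul]
      nlinarith [le_abs_self (φ z)]
    have h2 := h _ h1
    simp only [map_add, map_smul, smul_eq_mul, h0, mul_zero, zero_add] at h2
    nlinarith
  have := key (-z)
  rw [map_neg] at this
  exact le_antisymm (key z) (neg_nonpos.1 this)

/-- If `φ w < 0` implies `ψ w ≤ 0` and neither form vanishes, then they have the same kernel. -/
lemma eq_zero_iff_of_neg_imp_nonpos {F : Type*} [NormedAddCommGroup F] [NormedSpace ℝ F]
    {φ ψ : F →L[ℝ] ℝ} (hφ : φ ≠ 0) (hψ : ψ ≠ 0) (h : ∀ w, φ w < 0 → ψ w ≤ 0) (w : F) :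
    φ w = 0 ↔ ψ w = 0 := by
  have hneg {u : F} (hu : φ u < 0) : ψ u < 0 := neg_of_neg_imp_nonpos hψ h hu
  constructor
  · intro hw
    obtain ⟨v, hv⟩ : ∃ v, φ v < 0 := by
      obtain ⟨v, hv⟩ := DFunLike.ne_iff.1 hφ
      rcases lt_or_gt_of_ne hv with hv | hv
      · exact ⟨v, hv⟩
      · exact ⟨-v, by rw [map_neg]; exact neg_neg_of_pos hv⟩
    by_contra hne
    -- Moving along `w` leaves `φ` unchanged; the coefficient is chosen so that `ψ` vanishes.
    have h1 : φ (v + (-ψ v / ψ w) • w) < 0 := by simpa [hw] using hv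
    have h2 := hneg h1
    rw [map_add, map_smul, smul_eq_mul, div_mul_cancel₀ _ hne] at h2
    linarith
  · intro hw
    by_contra hne
    rcases lt_or_gt_of_ne hne with hlt | hgt
    · exact (hneg hlt).ne hw
    · have h1 : ψ (-w) < 0 := hneg (by rw [map_neg]; exact neg_neg_of_pos hgt)
      rw [map_neg, hw, neg_zero] at h1
      exact lt_irrefl _ h1

/-- If `f x = k x = 0` and `k ≤ 0` wherever `f < 0` near `x`, then the same holds for the
derivatives at `x`. -/
lemma HasFDerivAt.nonpos_of_neg {F : Type*} [NormedAddCommGroup F] [NormedSpace ℝ F]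
    {f k : F → ℝ} {φ ψ : F →L[ℝ] ℝ} {x : F} (hf : HasFDerivAt f φ x) (hk : HasFDerivAt k ψ x)
    (hfx : f x = 0) (hkx : k x = 0) (h : ∀ᶠ y in 𝓝 x, f y < 0 → k y ≤ 0) {w : F}
    (hw : φ w < 0) : ψ w ≤ 0 := by
  have slope {l : F → ℝ} {χ : F →L[ℝ] ℝ} (hl : HasFDerivAt l χ x) (hlx : l x = 0) :
      Tendsto (fun t : ℝ ↦ t⁻¹ * l (x + t • w)) (𝓝[>] 0) (𝓝 (χ w)) := by
    simpa [hlx] using (hl.hasLineDerivAt w).tendsto_slope_zero_right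
  have hline : Tendsto (fun t : ℝ ↦ x + t • w) (𝓝[>] 0) (𝓝 x) := by
    have : Continuous fun t : ℝ ↦ x + t • w := by fun_prop
    simpa using (this.tendsto 0).mono_left nhdsWithin_le_nhds
  -- For small `t > 0` the quotient of `f` along `w` is negative, hence that of `k` is nonpositive,
  -- and so is its limit.
  refine le_of_tendsto (slope hk hkx) ?_
  filter_upwards [(slope hf hfx).eventually_lt_const hw, hline.eventually h,
    self_mem_nhdsWithin] with t ht hht htpos
  have htpos' : 0 < t⁻¹ := inv_pos.2 htpos
  exact mul_nonpos_of_nonneg_of_nonpos htpos'.le (hht (neg_of_mul_neg_right ht htpos'.le))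

section BoundaryDefining

variable {F : Type*} [NormedAddCommGroup F] [NormedSpace ℝ F]
  {S : Type*} [TopologicalSpace S] [ChartedSpace F S]

lemma IsBoundaryDefiningAt.mdifferentiableAt {A : Set S} {p : S} {h : S → ℝ}
    (hh : IsBoundaryDefiningAt (F := F) A p h) : MDifferentiableAt 𝓘(ℝ, F) 𝓘(ℝ, ℝ) h p := by
  obtain ⟨-, -, U, hU, hpU, hs, -⟩ := hh
  exact (hs.contMDiffAt (hU.mem_nhds hpU)).mdifferentiableAt (by simp)

/-- By continuity, a nonzero value at `p` would put a whole neighbourhood of `p` inside `A` or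
outside it. -/
lemma IsBoundaryDefiningAt.apply_eq_zero {A : Set S} {p : S} {h : S → ℝ}
    (hh : IsBoundaryDefiningAt (F := F) A p h) : h p = 0 := by
  have hc := hh.mdifferentiableAt.continuousAt
  obtain ⟨hp, -, U, hU, hpU, -, hq⟩ := hh
  rw [frontier_eq_closure_inter_closure] at hp
  by_contra hne
  rcases lt_or_gt_of_ne hne with hlt | hgt
  · have hev : ∀ᶠ q in 𝓝 p, q ∈ A := by
      filter_upwards [hU.mem_nhds hpU, hc.eventually_lt_const hlt] with q hqU hlt
      exact (hq q hqU).1 hlt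
    exact (mem_closure_iff_frequently.1 hp.2) (hev.mono fun q hqA ↦ not_not.2 hqA)
  · refine (mem_closure_iff_frequently.1 hp.1) ?_
    filter_upwards [hU.mem_nhds hpU, hc.eventually_const_lt hgt] with q hqU hgt hqA
    exact absurd ((hq q hqU).2 hqA) (not_le.2 hgt)

/-- Moves the comparison of differentials to the model vector space, where
`HasFDerivAt.nonpos_of_neg` applies. -/
lemma IsBoundaryDefiningAt.hasFDerivAt {A : Set S} {p : S} {h : S → ℝ}
    (hh : IsBoundaryDefiningAt (F := F) A p h) :
    HasFDerivAt (h ∘ (extChartAt 𝓘(ℝ, F) p).symm)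
      (differentialAt (F := F) h p : F →L[ℝ] ℝ) (extChartAt 𝓘(ℝ, F) p p) := by
  have := hh.mdifferentiableAt.hasMFDerivAt.2
  rw [ModelWithCorners.range_eq_univ] at this
  exact hasFDerivWithinAt_univ.1 this

/-- At a common boundary point of a region and a larger region, inward directions for the smaller
region do not point out of the larger one. -/
lemma IsBoundaryDefiningAt.nonpos_of_subset {A C : Set S} {p : S} {h k : S → ℝ}
    (hh : IsBoundaryDefiningAt (F := F) C p h) (hk : IsBoundaryDefiningAt (F := F) A p k)
    (hCA : C ⊆ A) (w : TangentSpace 𝓘(ℝ, F) p) (hw : differentialAt h p w < 0) :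
    differentialAt k p w ≤ 0 := by
  refine HasFDerivAt.nonpos_of_neg hh.hasFDerivAt hk.hasFDerivAt ?_ ?_ ?_ hw
  · simpa using hh.apply_eq_zero
  · simpa using hk.apply_eq_zero
  · obtain ⟨-, -, U, hU, hpU, -, hq⟩ := hh
    obtain ⟨-, -, U', hU', hpU', -, hq'⟩ := hk
    have hev : ∀ᶠ q in 𝓝 p, h q < 0 → k q ≤ 0 := by
      filter_upwards [hU.mem_nhds hpU, hU'.mem_nhds hpU'] with q hqU hqU' hlt
      exact (hq' q hqU').2 (hCA ((hq q hqU).1 hlt))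
    have ht := continuousAt_extChartAt_symm (I := 𝓘(ℝ, F)) p
    rw [ContinuousAt, extChartAt_to_inv] at ht
    exact ht.eventually hev

variable {E : Type*} [NormedAddCommGroup E] [NormedSpace ℝ E]
  {M : Type*} [TopologicalSpace M] [ChartedSpace E M] [IsManifold 𝓘(ℝ, E) ∞ M]

/-- External tangency to a region passes to larger regions with smooth boundary, as long as the
point of tangency remains on the boundary. -/
lemma IsExternallyTangentAt.of_subset {g : LorentzMetric E M} {ι : S → M} {A C : Set S} {V : M}
    {p : S} (h : IsExternallyTangentAt (F := F) g ι C V p) (hA : HasSmoothBoundary F A)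
    (hCA : C ⊆ A) (hp : p ∈ frontier A) : IsExternallyTangentAt (F := F) g ι A V p := by
  obtain ⟨h, γ, hh, hγ, htan, u, hu, hneg⟩ := h
  obtain ⟨k, hk⟩ := hA p hp
  have hle := hh.nonpos_of_subset hk hCA
  -- The ray `γ` and its projected velocity `u` do not depend on the region; only the defining
  -- function changes.
  exact ⟨k, γ, hk, hγ,
    fun w ↦ (htan w).trans (eq_zero_iff_of_neg_imp_nonpos (F := F) hh.2.1 hk.2.1 hle w),
    u, hu, neg_of_neg_imp_nonpos (F := F) hk.2.1 hle hneg⟩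

/-- A lightsphere externally tangential to a region avoids the interior of that region, provided
the point of tangency is on the boundary of a Rindler-convex region containing it. -/
lemma IsRindlerConvex.disjoint_of_subset {g : LorentzMetric E M} {ι : S → M} {A C : Set S} {V : M}
    {p : S} (hA : IsRindlerConvex F g ι A) (hCA : C ⊆ A) (hp : p ∈ frontier A)
    (h : IsExternallyTangentAt (F := F) g ι C V p) :
    Disjoint (lightsphere g ι V) (interior C) :=
  (hA.2 V p (h.of_subset hA.1 hCA hp)).mono_right (interior_mono hCA)

end BoundaryDefining

theorem theoremA2
    {E : Type*} [NormedAddCommGroup E] [NormedSpace ℝ E] [FiniteDimensional ℝ E]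
    {M : Type*} [TopologicalSpace M] [ChartedSpace E M] [IsManifold 𝓘(ℝ, E) ∞ M]
    {F : Type*} [NormedAddCommGroup F] [NormedSpace ℝ F] [FiniteDimensional ℝ F]
    {S : Type*} [TopologicalSpace S] [ChartedSpace F S] [IsManifold 𝓘(ℝ, F) ∞ S]
    (g : LorentzMetric E M) (ι : S → M) (hι : IsSpacelikeSlice (F := F) g ι)
    (A B : Set S) (hA : IsRindlerConvex F g ι A) (hB : IsRindlerConvex F g ι B)
    (hAB : HasSmoothBoundary F (A ∩ B)) :
    IsRindlerConvex F g ι (A ∩ B) := by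
  refine ⟨hAB, fun V p h ↦ ?_⟩
  have hp : p ∈ frontier (A ∩ B) := by
    obtain ⟨_, _, hh, -⟩ := h
    exact hh.1
  rcases frontier_inter_subset A B hp with hp | hp
  · exact hA.disjoint_of_subset inter_subset_left hp.1 h
  · exact hB.disjoint_of_subset inter_subset_right hp.2 h
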